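/- For $v\in\mathbb{C}\setminus\{0,-1,-2,\dots\}$ let $\Phi(z,s,v)$ be the Hurwitz--Lerch zeta function with principal powers. For $|z|<1$ it is $\Phi(z,s,v)=\sum_{k\ge 0}z^k(v+k)^{-s}$. For $|z|=1$, $z\ne 1$, $\operatorname{Re}s>0$ it is $$\Phi(z,s,v)=\frac1{\Gamma(s)}\int_0^\infty\frac{t^{s-1}e^{-vt}}{1-ze^{-t}}\,dt\quad(\operatorname{Re}v>0),$$ extended to $\operatorname{Re}v\le 0$ by $\Phi(z,s,v)=\sum_{k=0}^{N-1}z^k(v+k)^{-s}+z^N\Phi(z,s,v+N)$, where $N$ is the least natural number with $\operatorname{Re}(v+N)>0$. Let $\psi=\Gamma'/\Gamma$ be the digamma function and, for $k\ge 0$ and $v\in\mathbb{C}\setminus\{0,-1,-2,\dots\}$, let $$\gamma_k(v)=\lim_{N\to\infty}\left(\sum_{m=0}^{N}\frac{\log^k(m+v)}{m+v}-\frac{\log^{k+1}(N+v)}{k+1}\right)$$ be the generalized Stieltjes constants (principal logarithm). Let $n\ge 0$ be an integer and let $a\in\mathbb{C}\setminus\{0,-1,-2,\dots\}$. Put $$p=\frac{a+n}{4n+2},\qquad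 q=\frac{a+3n+1}{4n+2},\qquad z_j=-e^{2\pi i j/(2n+1)}\quad(0\le j\le 2n),$$ and write $(-1)^x=e^{i\pi x}$. Then each function $s\mapsto\Phi(z_j,s,a)$, $0\le j\le 2n$, is analytic at $s=1$, and $$\sum_{j=0}^{2n}(-1)^{j\left(\frac1{2n+1}+1\right)}\,\partial_s\Phi(z_j,s,a)\Big|_{s=1}=\frac{(-1)^n}{2}\Big(-\gamma_1(p)+\gamma_1(q)+\log(4n+2)\,\big(\psi(p)-\psi(q)\big)\Big),$$ $$\sum_{j=0}^{2n}(-1)^{j\left(\frac1{2n+1}+1\right)}\,\partial_s^2\Phi(z_j,s,a)\Big|_{s=1}=\frac{(-1)^n}{2}\Big(\gamma_2(p)-\gamma_2(q)+2\log(4n+2)\,\big(\gamma_1(p)-\gamma_1(q)\big)-\big(\log(2n+1)\log(8n+4)+\log^2 2\big)\big(\psi(p)-\psi(q)\big)\Big).$$ -/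

import Mathlib

open Filter MeasureTheory

/-- The integral `(1 / Γ(s)) ∫₀^∞ t^(s-1) e^(-vt) / (1 - z e^(-t)) dt`. It converges absolutely
for `Re v > 0` and either `|z| ≤ 1`, `z ≠ 1`, `Re s > 0`, or `z = 1`, `Re s > 1`. -/
noncomputable def lerchIntegral (z s v : ℂ) : ℂ :=
  1 / Complex.Gamma s *
    ∫ t in Set.Ioi (0 : ℝ),
      (t : ℂ) ^ (s - 1) * Complex.exp (-v * t) / (1 - z * Complex.exp (-(t : ℂ)))

/-- The Hurwitz-Lerch zeta function `Φ(z, s, v)` for `v ≠ 0, -1, -2, …` (principal powers).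

* For `|z| < 1` and every `s` it is the series `∑ zᵏ (v + k)^(-s)`.
* On `|z| = 1` it is the continuation in `s` of the same series: for `Re v > 0` the number `N` of
  terms split off below is `0` and the value is `lerchIntegral z s v`; for `Re v ≤ 0` the first
  `N` terms of the series are split off, where `N` is the least natural number with
  `Re (v + N) > 0`, that is `Φ(z, s, v) = ∑_{k < N} zᵏ (v + k)^(-s) + z^N Φ(z, s, v + N)`.
  Here `Re s > 0` if `z ≠ 1`, and `Re s > 1` if `z = 1`. -/
noncomputable def lerchPhi (z s v : ℂ) : ℂ :=
  if ‖z‖ < 1 then ∑' k : ℕ, z ^ k * (v + k) ^ (-s)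
  else
    (∑ k ∈ Finset.range ⌊1 - v.re⌋₊, z ^ k * (v + k) ^ (-s)) +
      z ^ ⌊1 - v.re⌋₊ * lerchIntegral z s (v + (⌊1 - v.re⌋₊ : ℕ))

/-- The generalized Stieltjes constant
`γ_k(v) = lim_{N → ∞} (∑_{m=0}^N log(m + v)^k / (m + v) - log(N + v)^(k+1) / (k+1))`
for `v ≠ 0, -1, -2, …`, with the principal logarithm. -/
noncomputable def stieltjesGamma (k : ℕ) (v : ℂ) : ℂ :=
  limUnder atTop fun N : ℕ =>
    (∑ m ∈ Finset.range (N + 1), Complex.log (m + v) ^ k / (m + v)) -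
      Complex.log (N + v) ^ (k + 1) / (k + 1)

/-! The proof is a root-of-unity filter applied to a conditionally convergent series. For `‖z‖ = 1`,
`z ≠ 1`, the partial sums of `∑ z^k (a+k)^(-s)` converge uniformly to `lerchPhi` near `s = 1`, so
the function is analytic there and the series may be differentiated termwise
(`tendsto_iteratedDeriv_lerchPhi_one`).

With `ζ = e^(2πi/(2n+1))`, the weight times `z_j^k` is `(-1)^k ζ^(j(k+n+1))`. Summing over `j` keeps
only `k ≡ n` and `k ≡ 3n+1` modulo `4n+2`, with opposite signs (`sum_weight_mul_sum`). There `a + k`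
equals `(4n+2)(m+p)` or `(4n+2)(m+q)`, so its logarithm is `log(4n+2)` plus `log(m+p)` or
`log(m+q)`.

Expanding the `i`-th power leaves series of differences of `log^k(m+p)/(m+p)` and
`log^k(m+q)/(m+q)`. These sum to differences of Stieltjes constants (`tendsto_sum_log_pow_div_sub`)
and, for `k = 0`, of digamma values (`tendsto_sum_one_div_sub`). -/

/-! ### Existence of the Stieltjes constants, and their differences -/

theorem norm_log_le_log_add_pi {w : ℂ} {X : ℝ} (h1 : 1 ≤ w.re) (hX : ‖w‖ ≤ X) :
    ‖Complex.log w‖ ≤ Real.log X + Real.pi := by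
  have hw : 1 ≤ ‖w‖ := h1.trans (Complex.re_le_norm w)
  refine (Complex.norm_le_abs_re_add_abs_im _).trans (add_le_add ?_ ?_)
  · rw [Complex.log_re, abs_of_nonneg (Real.log_nonneg hw)]
    exact Real.log_le_log (by linarith) hX
  · rw [Complex.log_im]
    exact Complex.abs_arg_le_pi w

theorem hasDerivAt_log_pow_succ_div (k : ℕ) {w : ℂ} (hw : 0 < w.re) :
    HasDerivAt (fun w : ℂ => Complex.log w ^ (k + 1) / (k + 1)) (Complex.log w ^ k / w) w := by
  have hs : w ∈ Complex.slitPlane := Or.inl hw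
  have hk : (k : ℂ) + 1 ≠ 0 := Nat.cast_add_one_ne_zero k
  have h := ((Complex.hasDerivAt_log hs).pow (k + 1)).div_const ((k : ℂ) + 1)
  refine h.congr_deriv ?_
  push_cast
  field_simp

theorem hasDerivAt_log_pow_div_self (k : ℕ) {w : ℂ} (hw : 0 < w.re) :
    HasDerivAt (fun w : ℂ => Complex.log w ^ k / w)
      ((k * Complex.log w ^ (k - 1) - Complex.log w ^ k) / w ^ 2) w := by
  have hs : w ∈ Complex.slitPlane := Or.inl hw
  have h0 : w ≠ 0 := Complex.slitPlane_ne_zero hs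
  have h := ((Complex.hasDerivAt_log hs).pow k).div (hasDerivAt_id w) h0
  refine h.congr_deriv ?_
  simp only [id, Pi.pow_apply]
  field_simp

/-- The points used for mean value estimates to the left of `z`. -/
theorem mem_halfPlane_inter_closedBall {z w : ℂ} (hz : 2 ≤ z.re)
    (hw : w ∈ {w : ℂ | z.re - 1 ≤ w.re} ∩ Metric.closedBall z 1) :
    1 ≤ w.re ∧ z.re - 1 ≤ ‖w‖ ∧ ‖Complex.log w‖ ≤ Real.log (‖z‖ + 1) + Real.pi := by
  have h1 : z.re - 1 ≤ w.re := hw.1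
  have h2 : ‖w - z‖ ≤ 1 := by simpa [dist_eq_norm] using hw.2
  have h3 : 1 ≤ w.re := by linarith
  refine ⟨h3, h1.trans (Complex.re_le_norm w), norm_log_le_log_add_pi h3 ?_⟩
  calc ‖w‖ = ‖z + (w - z)‖ := by ring_nf
    _ ≤ ‖z‖ + 1 := (norm_add_le _ _).trans (by linarith)

theorem convex_halfPlane_inter_closedBall (z : ℂ) :
    Convex ℝ ({w : ℂ | z.re - 1 ≤ w.re} ∩ Metric.closedBall z 1) :=
  (convex_halfSpace_re_ge _).inter (convex_closedBall z 1)

theorem sub_ofReal_mem_halfPlane_inter_closedBall (z : ℂ) {t : ℝ} (h0 : 0 ≤ t) (h1 : t ≤ 1) :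
    z - t ∈ {w : ℂ | z.re - 1 ≤ w.re} ∩ Metric.closedBall z 1 := by
  constructor
  · simp only [Set.mem_ofPred_eq, Complex.sub_re, Complex.ofReal_re]
    linarith
  · simp [abs_of_nonneg h0, h1]

theorem norm_log_pow_succ_sub_le (k : ℕ) {z : ℂ} (hz : 2 ≤ z.re) {t : ℝ} (h0 : 0 ≤ t)
    (h1 : t ≤ 1) :
    ‖Complex.log z ^ (k + 1) / (k + 1) - Complex.log (z - t) ^ (k + 1) / (k + 1)‖ ≤
      (Real.log (‖z‖ + 1) + Real.pi) ^ k / (z.re - 1) := by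
  have hL : 0 ≤ Real.log (‖z‖ + 1) + Real.pi :=
    add_nonneg (Real.log_nonneg (by linarith [norm_nonneg z])) Real.pi_pos.le
  have hC : 0 ≤ (Real.log (‖z‖ + 1) + Real.pi) ^ k / (z.re - 1) :=
    div_nonneg (pow_nonneg hL k) (by linarith)
  have hz' := sub_ofReal_mem_halfPlane_inter_closedBall z le_rfl zero_le_one
  rw [Complex.ofReal_zero, sub_zero] at hz'
  refine ((convex_halfPlane_inter_closedBall z).norm_image_sub_le_of_norm_hasDerivWithin_le
    (C := (Real.log (‖z‖ + 1) + Real.pi) ^ k / (z.re - 1))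
    (fun w hw => (hasDerivAt_log_pow_succ_div k ?_).hasDerivWithinAt) ?_
    (sub_ofReal_mem_halfPlane_inter_closedBall z h0 h1) hz').trans ?_
  · linarith [(mem_halfPlane_inter_closedBall hz hw).1]
  · intro w hw
    obtain ⟨_, hb, hc⟩ := mem_halfPlane_inter_closedBall hz hw
    rw [norm_div, norm_pow]
    exact div_le_div₀ (pow_nonneg hL k) (pow_le_pow_left₀ (norm_nonneg _) hc k) (by linarith) hb
  · refine mul_le_of_le_one_right hC ?_
    simp [abs_of_nonneg h0, h1]

/-- The mean value inequality is used twice: on `log^k w / w`, then on the primitive minus its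
linear part at `z`. The resulting second power of `z.re - 1` makes the increments of the Stieltjes
sequence summable. -/
theorem norm_log_pow_succ_sub_sub_le (k : ℕ) {z : ℂ} (hz : 2 ≤ z.re) :
    ‖Complex.log z ^ (k + 1) / (k + 1) - Complex.log (z - 1) ^ (k + 1) / (k + 1)
        - Complex.log z ^ k / z‖ ≤
      (k + 1) * (Real.log (‖z‖ + 1) + Real.pi) ^ k / (z.re - 1) ^ 2 := by
  set B : ℝ := Real.log (‖z‖ + 1) + Real.pi with hB
  set C : ℝ := (k + 1) * B ^ k / (z.re - 1) ^ 2 with hCdef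
  have hL : 1 ≤ B := by
    have := Real.log_nonneg (show 1 ≤ ‖z‖ + 1 by linarith [norm_nonneg z])
    linarith [Real.pi_gt_three]
  have hC : 0 ≤ C := by positivity
  have hS := convex_halfPlane_inter_closedBall z
  have hz' := sub_ofReal_mem_halfPlane_inter_closedBall z le_rfl zero_le_one
  have hz1 := sub_ofReal_mem_halfPlane_inter_closedBall z zero_le_one le_rfl
  rw [Complex.ofReal_zero, sub_zero] at hz'
  rw [Complex.ofReal_one] at hz1
  have hf : ∀ w ∈ {w : ℂ | z.re - 1 ≤ w.re} ∩ Metric.closedBall z 1,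
      ‖Complex.log w ^ k / w - Complex.log z ^ k / z‖ ≤ C := by
    intro w hw
    refine (hS.norm_image_sub_le_of_norm_hasDerivWithin_le (C := C)
      (fun w hw => (hasDerivAt_log_pow_div_self k ?_).hasDerivWithinAt) ?_ hz' hw).trans ?_
    · linarith [(mem_halfPlane_inter_closedBall hz hw).1]
    · intro w hw
      obtain ⟨_, hb, hc⟩ := mem_halfPlane_inter_closedBall hz hw
      rw [norm_div, norm_pow]
      refine div_le_div₀ (by positivity) ?_ (pow_pos (by linarith) 2)
        (pow_le_pow_left₀ (by linarith) hb 2)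
      refine (norm_sub_le _ _).trans ?_
      rw [norm_mul, norm_pow, norm_pow, Complex.norm_natCast, add_mul, one_mul]
      refine add_le_add (mul_le_mul_of_nonneg_left ?_ (Nat.cast_nonneg k))
        (pow_le_pow_left₀ (norm_nonneg _) hc k)
      exact (pow_le_pow_left₀ (norm_nonneg _) hc _).trans
        (pow_le_pow_right₀ hL (Nat.sub_le k 1))
    · exact mul_le_of_le_one_right hC (by simpa [dist_eq_norm] using hw.2)
  have h := hS.norm_image_sub_le_of_norm_hasDerivWithin_le (C := C)
    (f := fun w : ℂ => Complex.log w ^ (k + 1) / (k + 1) - w * (Complex.log z ^ k / z))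
    (f' := fun w : ℂ => Complex.log w ^ k / w - 1 * (Complex.log z ^ k / z))
    (fun w hw => ((hasDerivAt_log_pow_succ_div k
      (by linarith [(mem_halfPlane_inter_closedBall hz hw).1])).sub
      ((hasDerivAt_id w).mul_const _)).hasDerivWithinAt)
    (fun w hw => by rw [one_mul]; exact hf w hw) hz1 hz'
  rw [show z - (z - 1) = 1 by ring, norm_one, mul_one] at h
  refine le_of_eq_of_le (congrArg _ ?_) h
  ring

theorem eventually_log_norm_add_pow_le (k : ℕ) (v : ℂ) :
    ∃ C : ℝ, 0 ≤ C ∧ ∀ᶠ N : ℕ in atTop,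
      (Real.log (‖(N : ℂ) + v‖ + 1) + Real.pi) ^ k ≤ C * (N : ℝ) ^ (1 / 2 : ℝ) ∧
        (N : ℝ) / 2 ≤ ((N : ℂ) + v).re - 1 := by
  -- The factor `exp π` absorbs the summand `π` into the logarithm; the 2 comes from `N + ‖v‖ + 1 ≤
  -- 2N` for large `N`.
  refine ⟨(Real.exp Real.pi * 2) ^ (1 / 2 : ℝ), by positivity, ?_⟩
  have hlim : Tendsto (fun N : ℕ => Real.exp Real.pi * ((N : ℝ) + (‖v‖ + 1))) atTop atTop :=
    (tendsto_atTop_add_const_right _ _ tendsto_natCast_atTop_atTop).const_mul_atTop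
      (Real.exp_pos _)
  have h1 := hlim.eventually
    ((isLittleO_log_rpow_rpow_atTop (s := 1 / 2) (k : ℝ) (by norm_num)).bound zero_lt_one)
  have h2 := tendsto_natCast_atTop_atTop.eventually (eventually_ge_atTop (‖v‖ + 1))
  have h3 := tendsto_natCast_atTop_atTop.eventually (eventually_ge_atTop (2 - 2 * v.re))
  filter_upwards [h1, h2, h3] with N h1 h2 h3
  have hv := norm_nonneg v
  have hX : 0 < (N : ℝ) + (‖v‖ + 1) := by positivity
  refine ⟨?_, by simp only [Complex.add_re, Complex.natCast_re]; linarith⟩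
  rw [one_mul, Real.rpow_natCast, Real.log_mul (Real.exp_pos _).ne' hX.ne', Real.log_exp,
    Real.norm_of_nonneg (by positivity : 0 ≤ (Real.exp Real.pi * ((N : ℝ) + (‖v‖ + 1))) ^ (1 / 2 : ℝ))]
    at h1
  rw [← Real.mul_rpow (by positivity) (by positivity)]
  have hn : ‖(N : ℂ) + v‖ ≤ N + ‖v‖ := (norm_add_le _ _).trans (by simp)
  have hlog : 0 ≤ Real.log (‖(N : ℂ) + v‖ + 1) :=
    Real.log_nonneg (by linarith [norm_nonneg ((N : ℂ) + v)])
  calc (Real.log (‖(N : ℂ) + v‖ + 1) + Real.pi) ^ k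
      ≤ (Real.pi + Real.log ((N : ℝ) + (‖v‖ + 1))) ^ k := by
        refine pow_le_pow_left₀ (add_nonneg hlog Real.pi_pos.le) ?_ k
        rw [add_comm]
        exact add_le_add_right (Real.log_le_log (by positivity) (by linarith)) _
    _ ≤ _ := (le_abs_self _).trans h1
    _ ≤ _ := by
        refine Real.rpow_le_rpow (by positivity) ?_ (by norm_num)
        rw [mul_assoc]
        gcongr
        linarith

theorem tendsto_stieltjesGamma (k : ℕ) (v : ℂ) :
    Tendsto (fun N : ℕ => (∑ m ∈ Finset.range (N + 1), Complex.log (m + v) ^ k / (m + v)) -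
      Complex.log (N + v) ^ (k + 1) / (k + 1)) atTop (nhds (stieltjesGamma k v)) := by
  refine tendsto_nhds_limUnder ?_
  set u : ℕ → ℂ := fun N => (∑ m ∈ Finset.range (N + 1), Complex.log (m + v) ^ k / (m + v)) -
      Complex.log (N + v) ^ (k + 1) / (k + 1) with hu
  obtain ⟨C, hC0, hC⟩ := eventually_log_norm_add_pow_le k v
  have hsum : Summable fun N : ℕ => u (N + 1) - u N := by
    have hs : Summable fun N : ℕ => 4 * (k + 1) * C * ((N : ℝ) ^ (-(3 / 2) : ℝ)) :=
      (Real.summable_nat_rpow.mpr (by norm_num)).mul_left _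
    refine Summable.of_norm_bounded_eventually_nat ((summable_nat_add_iff 1).mpr hs) ?_
    filter_upwards [(tendsto_add_atTop_nat 1).eventually hC, eventually_ge_atTop 3] with N hN hN3
    obtain ⟨hN1, hN2⟩ := hN
    have hNpos : (4 : ℝ) ≤ ((N + 1 : ℕ) : ℝ) := by exact_mod_cast Nat.succ_le_succ hN3
    have hb := norm_log_pow_succ_sub_sub_le k (z := ((N + 1 : ℕ) : ℂ) + v) (by linarith)
    have he : u (N + 1) - u N = -(Complex.log (((N + 1 : ℕ) : ℂ) + v) ^ (k + 1) / (k + 1) -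
        Complex.log (((N + 1 : ℕ) : ℂ) + v - 1) ^ (k + 1) / (k + 1) -
        Complex.log (((N + 1 : ℕ) : ℂ) + v) ^ k / (((N + 1 : ℕ) : ℂ) + v)) := by
      simp only [hu]
      rw [Finset.sum_range_succ _ (N + 1), show ((N + 1 : ℕ) : ℂ) + v - 1 = N + v by
        push_cast; ring]
      ring
    rw [he, norm_neg]
    refine hb.trans ?_
    set x : ℝ := ((N + 1 : ℕ) : ℝ) with hx
    have hxp : 0 < x := by linarith
    have hpow : x ^ (-(3 / 2) : ℝ) = x ^ (1 / 2 : ℝ) / x ^ 2 := by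
      rw [← Real.rpow_natCast, ← Real.rpow_sub hxp]
      norm_num
    rw [hpow]
    calc _ ≤ (k + 1) * (C * x ^ (1 / 2 : ℝ)) / (x / 2) ^ 2 := by gcongr
      _ = _ := by field_simp; ring
  have ht := hsum.hasSum.tendsto_sum_nat
  simp only [Finset.sum_range_sub] at ht
  exact ⟨_, (ht.add_const (u 0)).congr fun N => by ring⟩

/-- The subtracted terms for `p` and `p + t` differ by `O(N^(-1/2))`, so they cancel in the limit.
-/
theorem tendsto_sum_log_pow_div_sub (k : ℕ) (p : ℂ) {t : ℝ} (h0 : 0 ≤ t) (h1 : t ≤ 1) :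
    Tendsto (fun M : ℕ => ∑ m ∈ Finset.range M,
      (Complex.log (m + p) ^ k / (m + p) - Complex.log (m + (p + t)) ^ k / (m + (p + t))))
      atTop (nhds (stieltjesGamma k p - stieltjesGamma k (p + t))) := by
  rw [← tendsto_add_atTop_iff_nat 1]
  have hdiff : Tendsto (fun N : ℕ => Complex.log (N + (p + t)) ^ (k + 1) / (k + 1) -
      Complex.log (N + p) ^ (k + 1) / (k + 1)) atTop (nhds 0) := by
    obtain ⟨C, hC0, hC⟩ := eventually_log_norm_add_pow_le k (p + t)
    refine squeeze_zero_norm' (a := fun N : ℕ => 2 * C * (N : ℝ) ^ (-(1 / 2) : ℝ)) ?_ ?_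
    · filter_upwards [hC, eventually_ge_atTop 4] with N hN hN4
      obtain ⟨hN1, hN2⟩ := hN
      have hx4 : (4 : ℝ) ≤ N := by exact_mod_cast hN4
      have hb := norm_log_pow_succ_sub_le k (z := (N : ℂ) + (p + t)) (by linarith) h0 h1
      rw [show (N : ℂ) + (p + t) - t = N + p by ring] at hb
      refine hb.trans ?_
      have hxp : (0 : ℝ) < N := by linarith
      have hpow : (N : ℝ) ^ (-(1 / 2) : ℝ) = (N : ℝ) ^ (1 / 2 : ℝ) / N := by
        nth_rewrite 3 [← Real.rpow_one (N : ℝ)]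
        rw [← Real.rpow_sub hxp]
        norm_num
      rw [hpow]
      calc _ ≤ (C * (N : ℝ) ^ (1 / 2 : ℝ)) / ((N : ℝ) / 2) := by gcongr
        _ = _ := by field_simp
    · rw [← mul_zero (2 * C)]
      exact ((tendsto_rpow_neg_atTop (by norm_num)).comp tendsto_natCast_atTop_atTop).const_mul _
  have h := ((tendsto_stieltjesGamma k p).sub (tendsto_stieltjesGamma k (p + t))).sub hdiff
  rw [sub_zero] at h
  refine h.congr fun N => ?_
  rw [Finset.sum_sub_distrib]
  ring

/-! ### The digamma function as a limit of harmonic-type sums -/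

theorem one_add_mul_ofReal_mem_slitPlane {z : ℂ} (hz : 0 < z.re) {r : ℝ} (hr : 0 ≤ r) :
    1 + z * r ∈ Complex.slitPlane := by
  left
  simp only [Complex.add_re, Complex.one_re, Complex.mul_re, Complex.ofReal_re, Complex.ofReal_im,
    mul_zero, sub_zero]
  positivity

theorem one_le_norm_one_add_mul_ofReal {z : ℂ} (hz : 0 < z.re) {r : ℝ} (hr : 0 ≤ r) :
    1 ≤ ‖1 + z * (r : ℂ)‖ := by
  refine le_trans ?_ (Complex.re_le_norm _)
  simp only [Complex.add_re, Complex.one_re, Complex.mul_re, Complex.ofReal_re, Complex.ofReal_im,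
    mul_zero, sub_zero]
  linarith [mul_nonneg hz.le hr]

/-- Both terms are `r + O(r^2)`. With `r = 1/(m+1)` this gives a summable bound on
`logGammaTermDeriv`, uniform for bounded `z` in the right half-plane. -/
theorem norm_log_one_add_sub_div_le {z : ℂ} (hz : 0 < z.re) {r R : ℝ} (hr : 0 ≤ r)
    (hR : ‖z‖ ≤ R) : ‖(Real.log (1 + r) : ℂ) - r / (1 + z * r)‖ ≤ (1 + R) * r ^ 2 := by
  have hs := Complex.slitPlane_ne_zero (one_add_mul_ofReal_mem_slitPlane hz hr)
  have h1 : |Real.log (1 + r) - r| ≤ r ^ 2 := by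
    have ha := Real.log_le_sub_one_of_pos (show 0 < 1 + r by linarith)
    have hb := Real.one_sub_inv_le_log_of_pos (show 0 < 1 + r by linarith)
    have hc : r - r ^ 2 ≤ 1 - (1 + r)⁻¹ := by
      have : 1 - (1 + r)⁻¹ = r / (1 + r) := by field_simp; ring
      rw [this, le_div_iff₀ (by linarith)]
      nlinarith [pow_nonneg hr 3]
    rw [abs_le]
    constructor <;> nlinarith [sq_nonneg r]
  have h2 : ‖(r : ℂ) - r / (1 + z * r)‖ ≤ R * r ^ 2 := by
    have he : (r : ℂ) - r / (1 + z * r) = z * (r : ℂ) ^ 2 / (1 + z * r) := by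
      rw [eq_div_iff hs, sub_mul, div_mul_cancel₀ _ hs]
      ring
    rw [he, norm_div, norm_mul, norm_pow, Complex.norm_real, Real.norm_of_nonneg hr]
    refine (div_le_self (by positivity) (one_le_norm_one_add_mul_ofReal hz hr)).trans ?_
    gcongr
  calc ‖(Real.log (1 + r) : ℂ) - r / (1 + z * r)‖
      = ‖((Real.log (1 + r) - r : ℝ) : ℂ) + (r - r / (1 + z * r))‖ := by push_cast; ring_nf
    _ ≤ r ^ 2 + R * r ^ 2 := by
        refine (norm_add_le _ _).trans (add_le_add ?_ h2)
        rwa [Complex.norm_real]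
    _ = _ := by ring

/-- The terms of the series of `log Γ(z + 1)`. -/
noncomputable def logGammaTerm (m : ℕ) (z : ℂ) : ℂ :=
  z * (Real.log (1 + (m + 1 : ℝ)⁻¹) : ℂ) - Complex.log (1 + z * ((m + 1 : ℝ)⁻¹ : ℝ))

/-- The derivative of `logGammaTerm`. -/
noncomputable def logGammaTermDeriv (m : ℕ) (z : ℂ) : ℂ :=
  (Real.log (1 + (m + 1 : ℝ)⁻¹) : ℂ) - ((m + 1 : ℝ)⁻¹ : ℝ) / (1 + z * ((m + 1 : ℝ)⁻¹ : ℝ))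

theorem hasDerivAt_logGammaTerm (m : ℕ) {z : ℂ} (hz : 0 < z.re) :
    HasDerivAt (logGammaTerm m) (logGammaTermDeriv m z) z := by
  have hr : 0 ≤ (m + 1 : ℝ)⁻¹ := by positivity
  have h := ((hasDerivAt_id z).mul_const (Real.log (1 + (m + 1 : ℝ)⁻¹) : ℂ)).sub
    ((((hasDerivAt_id z).mul_const (((m + 1 : ℝ)⁻¹ : ℝ) : ℂ)).const_add 1).clog
      (one_add_mul_ofReal_mem_slitPlane hz hr))
  simp only [one_mul] at h
  exact h

theorem logGammaTerm_one (m : ℕ) : logGammaTerm m 1 = 0 := by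
  have hr : 0 ≤ 1 + (m + 1 : ℝ)⁻¹ := by positivity
  rw [logGammaTerm, one_mul, one_mul, Complex.ofReal_log hr]
  push_cast
  ring

theorem summable_inv_add_one_sq (C : ℝ) : Summable fun m : ℕ => C * ((m + 1 : ℝ)⁻¹) ^ 2 := by
  have h := (summable_nat_add_iff 1).mpr (Real.summable_nat_pow_inv.mpr one_lt_two)
  refine (h.mul_left C).congr fun m => ?_
  push_cast
  rw [inv_pow]

theorem hasDerivAt_tsum_logGammaTerm {z : ℂ} (hz : 0 < z.re) :
    (Summable fun m => logGammaTerm m z) ∧ (Summable fun m => logGammaTermDeriv m z) ∧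
    HasDerivAt (fun w => ∑' m, logGammaTerm m w) (∑' m, logGammaTermDeriv m z) z := by
  set R : ℝ := ‖z‖ + 2
  set U : Set ℂ := {w : ℂ | 0 < w.re} ∩ Metric.ball 0 R
  have hU : IsOpen U := (isOpen_lt continuous_const Complex.continuous_re).inter Metric.isOpen_ball
  have hUc : Convex ℝ U := (convex_halfSpace_re_gt _).inter (convex_ball 0 R)
  have hzU : z ∈ U := ⟨hz, by simp [R]⟩
  have h1U : (1 : ℂ) ∈ U := ⟨by simp, by
    rw [mem_ball_zero_iff, norm_one]
    linarith [norm_nonneg z, show R = ‖z‖ + 2 from rfl]⟩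
  have hd : ∀ (m : ℕ) (w : ℂ), w ∈ U → HasDerivAt (logGammaTerm m) (logGammaTermDeriv m w) w :=
    fun m w hw => hasDerivAt_logGammaTerm m hw.1
  have hb : ∀ (m : ℕ) (w : ℂ), w ∈ U → ‖logGammaTermDeriv m w‖ ≤
      (1 + R) * ((m + 1 : ℝ)⁻¹) ^ 2 := fun m w hw =>
    norm_log_one_add_sub_div_le hw.1 (by positivity) (mem_ball_zero_iff.mp hw.2).le
  -- Every term vanishes at 1, which provides the base point needed for termwise differentiation.
  have h1 : Summable fun m => logGammaTerm m 1 := by simp only [logGammaTerm_one, summable_zero]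
  exact ⟨summable_of_summable_hasDerivAt_of_isPreconnected (summable_inv_add_one_sq _) hU
      hUc.isPreconnected hd hb h1U h1 hzU,
    .of_norm_bounded (summable_inv_add_one_sq _) fun m => hb m z hzU,
    hasDerivAt_tsum_of_isPreconnected (summable_inv_add_one_sq _) hU
      hUc.isPreconnected hd hb h1U h1 hzU⟩

theorem sum_log_one_add_inv (N : ℕ) :
    ∑ m ∈ Finset.range N, Real.log (1 + (m + 1 : ℝ)⁻¹) = Real.log (N + 1) := by
  induction N with
  | zero => simp
  | succ N ih =>
    rw [Finset.sum_range_succ, ih, ← Real.log_mul (by positivity) (by positivity)]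
    congr 1
    push_cast
    field_simp

/-- The logarithms telescope to `log(N+1)`, whereas `GammaSeq` carries `N^z`; the correction term
accounts for this and tends to 0. -/
theorem exp_sum_logGammaTerm {z : ℂ} (hz : 0 < z.re) {N : ℕ} (hN : N ≠ 0) :
    Complex.exp (∑ m ∈ Finset.range N, logGammaTerm m z -
      z * ((Real.log (N + 1) - Real.log N : ℝ) : ℂ)) = z * Complex.GammaSeq z N := by
  have hz0 : z ≠ 0 := fun h => by simp [h] at hz
  have hN' : (N : ℂ) ≠ 0 := Nat.cast_ne_zero.mpr hN
  have hne : ∀ m : ℕ, z + m + 1 ≠ 0 := fun m h => by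
    have := congrArg Complex.re h
    simp only [Complex.add_re, Complex.natCast_re, Complex.one_re, Complex.zero_re] at this
    have hm : (0 : ℝ) ≤ m := Nat.cast_nonneg m
    linarith
  have h1 : ∑ m ∈ Finset.range N, logGammaTerm m z - z * ((Real.log (N + 1) - Real.log N : ℝ) : ℂ)
      = Complex.log N * z -
        ∑ m ∈ Finset.range N, Complex.log (1 + z * ((m + 1 : ℝ)⁻¹ : ℝ)) := by
    simp only [logGammaTerm]
    rw [Finset.sum_sub_distrib, ← Finset.mul_sum, ← Complex.ofReal_sum, sum_log_one_add_inv,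
      ← Complex.natCast_log]
    push_cast
    ring
  have h2 : Complex.exp (∑ m ∈ Finset.range N, Complex.log (1 + z * ((m + 1 : ℝ)⁻¹ : ℝ))) =
      (∏ m ∈ Finset.range N, (z + m + 1)) / (N.factorial : ℂ) := by
    rw [Complex.exp_sum, ← Finset.prod_range_add_one_eq_factorial, Nat.cast_prod,
      ← Finset.prod_div_distrib]
    refine Finset.prod_congr rfl fun m _ => ?_
    rw [Complex.exp_log (Complex.slitPlane_ne_zero
      (one_add_mul_ofReal_mem_slitPlane hz (by positivity)))]
    have : (m : ℂ) + 1 ≠ 0 := Nat.cast_add_one_ne_zero m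
    push_cast
    field_simp
    ring
  have h3 : (∏ m ∈ Finset.range N, (z + m + 1)) ≠ 0 := Finset.prod_ne_zero_iff.mpr fun m _ => hne m
  have h4 : ∏ j ∈ Finset.range (N + 1), (z + j) = (∏ m ∈ Finset.range N, (z + m + 1)) * z := by
    rw [Finset.prod_range_succ']
    simp [add_assoc]
  rw [h1, Complex.exp_sub, h2, ← Complex.cpow_def_of_ne_zero hN', Complex.GammaSeq, h4]
  have : (N.factorial : ℂ) ≠ 0 := Nat.cast_ne_zero.mpr N.factorial_ne_zero
  field_simp

theorem Gamma_add_one_eq_exp_tsum {z : ℂ} (hz : 0 < z.re) :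
    Complex.Gamma (z + 1) = Complex.exp (∑' m, logGammaTerm m z) := by
  have hz0 : z ≠ 0 := fun h => by simp [h] at hz
  rw [Complex.Gamma_add_one z hz0]
  have h1 := (Complex.GammaSeq_tendsto_Gamma z).const_mul z
  have h2 := (hasDerivAt_tsum_logGammaTerm hz).1.hasSum.tendsto_sum_nat
  have h3 : Tendsto (fun N : ℕ => z * ((Real.log (N + 1) - Real.log N : ℝ) : ℂ)) atTop
      (nhds (z * ((0 : ℝ) : ℂ))) :=
    ((Complex.continuous_ofReal.tendsto 0).comp Real.tendsto_log_nat_add_one_sub_log).const_mul z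
  rw [Complex.ofReal_zero, mul_zero] at h3
  have h4 := (Complex.continuous_exp.tendsto _).comp (h2.sub h3)
  rw [sub_zero] at h4
  refine tendsto_nhds_unique h1 (h4.congr' ?_)
  filter_upwards [eventually_ne_atTop 0] with N hN using exp_sum_logGammaTerm hz hN

theorem hasSum_logGammaTermDeriv {z : ℂ} (hz : 0 < z.re) :
    HasSum (fun m => logGammaTermDeriv m z) (Complex.digamma (z + 1)) := by
  obtain ⟨-, hs, hd⟩ := hasDerivAt_tsum_logGammaTerm hz
  suffices h : Complex.digamma (z + 1) = ∑' m, logGammaTermDeriv m z from h ▸ hs.hasSum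
  have hev : (fun w => Complex.Gamma (w + 1)) =ᶠ[nhds z]
      fun w => Complex.exp (∑' m, logGammaTerm m w) := by
    filter_upwards [(isOpen_lt continuous_const Complex.continuous_re).mem_nhds hz] with w hw
      using Gamma_add_one_eq_exp_tsum hw
  have h1 := hd.cexp.congr_of_eventuallyEq hev
  rw [Complex.digamma_def, logDeriv_apply, ← deriv_comp_add_const, h1.deriv,
    Gamma_add_one_eq_exp_tsum hz, mul_div_cancel_left₀ _ (Complex.exp_ne_zero _)]

theorem sum_logGammaTermDeriv (z : ℂ) (N : ℕ) :
    ∑ m ∈ Finset.range N, logGammaTermDeriv m z =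
      (Real.log (N + 1) : ℂ) - ∑ m ∈ Finset.range N, 1 / (m + (z + 1)) := by
  simp only [logGammaTermDeriv]
  rw [Finset.sum_sub_distrib, ← Complex.ofReal_sum, sum_log_one_add_inv]
  congr 1
  refine Finset.sum_congr rfl fun m _ => ?_
  have hm : (m : ℂ) + 1 ≠ 0 := Nat.cast_add_one_ne_zero m
  push_cast
  rw [show (m : ℂ) + (z + 1) = (m + 1) * (1 + z * (m + 1 : ℂ)⁻¹) by field_simp; ring, ← div_div,
    one_div]

theorem tendsto_sum_one_div_sub_log_of_add_one {z : ℂ} (hz : ∀ m : ℕ, z ≠ -m)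
    (h : Tendsto (fun N : ℕ => ∑ m ∈ Finset.range N, 1 / (m + (z + 1)) - (Real.log (N + 1) : ℂ))
      atTop (nhds (-Complex.digamma (z + 1)))) :
    Tendsto (fun N : ℕ => ∑ m ∈ Finset.range N, 1 / (m + z) - (Real.log (N + 1) : ℂ))
      atTop (nhds (-Complex.digamma z)) := by
  have h1 : Tendsto (fun N : ℕ => 1 / ((N : ℂ) + z)) atTop (nhds 0) := by
    simp only [one_div]
    exact tendsto_inv₀_cobounded.comp (tendsto_add_const_cobounded z |>.comp
      tendsto_natCast_atTop_cobounded)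
  have h2 := (h.sub h1).add_const (z⁻¹)
  rw [Complex.digamma_apply_add_one z hz, show -(Complex.digamma z + z⁻¹) - 0 + z⁻¹ =
    -Complex.digamma z by ring] at h2
  refine h2.congr fun N => ?_
  have h3 := (Finset.sum_range_succ (fun m : ℕ => 1 / ((m : ℂ) + z)) N).symm.trans
    (Finset.sum_range_succ' (fun m : ℕ => 1 / ((m : ℂ) + z)) N)
  rw [eq_sub_of_add_eq h3]
  have h4 : ∀ m : ℕ, 1 / (((m + 1 : ℕ) : ℂ) + z) = 1 / (m + (z + 1)) := fun m => by
    push_cast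
    ring_nf
  simp only [h4, Nat.cast_zero, zero_add, one_div]
  ring

theorem tendsto_sum_one_div_sub_log {z : ℂ} (hz : ∀ m : ℕ, z ≠ -m) :
    Tendsto (fun N : ℕ => ∑ m ∈ Finset.range N, 1 / (m + z) - (Real.log (N + 1) : ℂ))
      atTop (nhds (-Complex.digamma z)) := by
  -- Induction on the number of unit shifts: `k = 0` means `z.re > 1`, so the series applies at `z -
  -- 1`; otherwise the functional equation of digamma moves from `z + 1` back to `z`.
  obtain ⟨k, hk⟩ := exists_nat_gt (1 - z.re)
  induction k generalizing z with
  | zero =>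
    have hz' : 0 < (z - 1).re := by
      simp only [Nat.cast_zero, Complex.sub_re, Complex.one_re] at hk ⊢
      linarith
    have h := (hasSum_logGammaTermDeriv hz').tendsto_sum_nat.neg
    simp only [sum_logGammaTermDeriv, neg_sub, sub_add_cancel] at h
    exact h
  | succ k ih =>
    refine tendsto_sum_one_div_sub_log_of_add_one hz (ih (fun m h => hz (m + 1) ?_) ?_)
    · push_cast
      linear_combination h
    · push_cast at hk
      simp only [Complex.add_re, Complex.one_re]
      linarith

theorem tendsto_sum_one_div_sub {p q : ℂ} (hp : ∀ m : ℕ, p ≠ -m) (hq : ∀ m : ℕ, q ≠ -m) :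
    Tendsto (fun N : ℕ => ∑ m ∈ Finset.range N, (1 / (m + p) - 1 / (m + q)))
      atTop (nhds (-(Complex.digamma p - Complex.digamma q))) := by
  have h := (tendsto_sum_one_div_sub_log hp).sub (tendsto_sum_one_div_sub_log hq)
  rw [show -Complex.digamma p - -Complex.digamma q = -(Complex.digamma p - Complex.digamma q) by
    ring] at h
  refine h.congr fun N => ?_
  rw [Finset.sum_sub_distrib]
  ring

/-! ### The Lerch integral and its recurrence in `v` -/

theorem norm_cpow_mul_exp_neg_mul (s v : ℂ) {t : ℝ} (ht : 0 < t) :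
    ‖(t : ℂ) ^ (s - 1) * Complex.exp (-v * t)‖ = t ^ (s.re - 1) * Real.exp (-v.re * t) := by
  rw [norm_mul, Complex.norm_cpow_eq_rpow_re_of_pos ht, Complex.norm_exp]
  simp

theorem integrableOn_rpow_sub_one_mul_exp {σ b : ℝ} (hσ : 0 < σ) (hb : 0 < b) :
    IntegrableOn (fun t : ℝ => t ^ (σ - 1) * Real.exp (-b * t)) (Set.Ioi 0) := by
  simpa using integrableOn_rpow_mul_exp_neg_mul_rpow (by linarith : -1 < σ - 1) one_pos hb

theorem continuousOn_cpow_mul_exp (s v : ℂ) :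
    ContinuousOn (fun t : ℝ => (t : ℂ) ^ (s - 1) * Complex.exp (-v * t)) (Set.Ioi 0) := by
  refine ContinuousOn.mul (fun t ht => ?_) (by fun_prop)
  exact (Complex.continuousAt_ofReal_cpow_const _ _ (Or.inr (ne_of_gt ht))).continuousWithinAt

theorem integrableOn_cpow_mul_exp {s v : ℂ} (hs : 0 < s.re) (hv : 0 < v.re) :
    IntegrableOn (fun t : ℝ => (t : ℂ) ^ (s - 1) * Complex.exp (-v * t)) (Set.Ioi 0) := by
  refine (integrableOn_rpow_sub_one_mul_exp hs hv).mono'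
    ((continuousOn_cpow_mul_exp s v).aestronglyMeasurable measurableSet_Ioi) ?_
  filter_upwards [ae_restrict_mem measurableSet_Ioi] with t ht
  rw [norm_cpow_mul_exp_neg_mul s v ht]

theorem hasDerivAt_integral_cpow_mul_exp {s v : ℂ} (hs : 0 < s.re) (hv : 0 < v.re) :
    HasDerivAt (fun v : ℂ => ∫ t in Set.Ioi (0 : ℝ), (t : ℂ) ^ (s - 1) * Complex.exp (-v * t))
      (∫ t in Set.Ioi (0 : ℝ), -((t : ℂ) ^ (s + 1 - 1) * Complex.exp (-v * t))) v := by
  -- On this neighbourhood `exp (-(v.re / 2) * t)` dominates the exponential factor.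
  have hU : {w : ℂ | v.re / 2 < w.re} ∈ nhds v :=
    (isOpen_lt continuous_const Complex.continuous_re).mem_nhds (by
      simp only [Set.mem_ofPred_eq]; linarith)
  have hs1 : 0 < (s + 1).re := by simp only [Complex.add_re, Complex.one_re]; linarith
  refine (hasDerivAt_integral_of_dominated_loc_of_deriv_le
    (F := fun (v : ℂ) (t : ℝ) => (t : ℂ) ^ (s - 1) * Complex.exp (-v * t))
    (F' := fun (v : ℂ) (t : ℝ) => -((t : ℂ) ^ (s + 1 - 1) * Complex.exp (-v * t)))
    (bound := fun t : ℝ => t ^ ((s + 1).re - 1) * Real.exp (-(v.re / 2) * t)) hU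
    (Eventually.of_forall fun w =>
      (continuousOn_cpow_mul_exp s w).aestronglyMeasurable measurableSet_Ioi)
    (integrableOn_cpow_mul_exp hs hv)
    ((continuousOn_cpow_mul_exp (s + 1) v).aestronglyMeasurable measurableSet_Ioi).neg ?_
    (integrableOn_rpow_sub_one_mul_exp hs1 (by linarith)) ?_).2
  · filter_upwards [ae_restrict_mem measurableSet_Ioi] with t ht w hw
    have ht' : 0 < t := ht
    rw [norm_neg, norm_cpow_mul_exp_neg_mul _ w ht]
    have hw' : v.re / 2 < w.re := hw
    gcongr
  · filter_upwards [ae_restrict_mem measurableSet_Ioi] with t ht w hw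
    have ht0 : (t : ℂ) ≠ 0 := Complex.ofReal_ne_zero.mpr (ne_of_gt ht)
    have h := ((((hasDerivAt_id w).neg.mul_const (t : ℂ)).cexp).const_mul ((t : ℂ) ^ (s - 1)))
    refine h.congr_deriv ?_
    rw [show s + 1 - 1 = (s - 1) + 1 by ring, Complex.cpow_add _ _ ht0, Complex.cpow_one]
    simp only [Pi.neg_apply, id]
    ring

/-- Both sides are holomorphic in `v` on the right half-plane and agree for real `v > 0`, so the
identity theorem applies. -/
theorem integral_cpow_mul_exp_neg_mul {s v : ℂ} (hs : 0 < s.re) (hv : 0 < v.re) :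
    ∫ t in Set.Ioi (0 : ℝ), (t : ℂ) ^ (s - 1) * Complex.exp (-v * t) =
      Complex.Gamma s * v ^ (-s) := by
  have hU : IsOpen {w : ℂ | 0 < w.re} := isOpen_lt continuous_const Complex.continuous_re
  have hf : AnalyticOnNhd ℂ (fun v : ℂ => ∫ t in Set.Ioi (0 : ℝ),
      (t : ℂ) ^ (s - 1) * Complex.exp (-v * t)) {w : ℂ | 0 < w.re} :=
    DifferentiableOn.analyticOnNhd (fun w hw =>
      (hasDerivAt_integral_cpow_mul_exp hs hw).differentiableAt.differentiableWithinAt) hU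
  have hg : AnalyticOnNhd ℂ (fun v : ℂ => Complex.Gamma s * v ^ (-s)) {w : ℂ | 0 < w.re} :=
    DifferentiableOn.analyticOnNhd (fun w hw =>
      ((differentiableAt_id.cpow_const (Or.inl hw)).const_mul _).differentiableWithinAt) hU
  have h1 : (1 : ℂ) ∈ {w : ℂ | 0 < w.re} := by simp
  refine hf.eqOn_of_preconnected_of_frequently_eq hg
    (convex_halfSpace_re_gt 0).isPreconnected h1 ?_ hv
  have ht : Tendsto (fun r : ℝ => (r : ℂ)) (nhdsWithin 1 {1}ᶜ) (nhdsWithin (1 : ℂ) {1}ᶜ) := by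
    refine tendsto_nhdsWithin_iff.mpr ⟨?_, ?_⟩
    · exact (Complex.continuous_ofReal.tendsto' 1 1 Complex.ofReal_one).mono_left
        nhdsWithin_le_nhds
    · filter_upwards [self_mem_nhdsWithin] with r hr
      simpa using hr
  refine ht.frequently (Eventually.frequently ?_)
  filter_upwards [nhdsWithin_le_nhds (Ioi_mem_nhds (zero_lt_one' ℝ))] with r hr
  have hr' : 0 < r := hr
  have h := Complex.integral_cpow_mul_exp_neg_mul_Ioi hs hr'
  simp only [neg_mul]
  rw [h, mul_comm, one_div, Complex.cpow_neg, Complex.inv_cpow]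
  rw [Complex.arg_ofReal_of_nonneg hr'.le]
  exact Real.pi_pos.ne

theorem one_sub_mul_ofReal_ne_zero {z : ℂ} (hz : ‖z‖ = 1) (hz1 : z ≠ 1) {r : ℝ} (h0 : 0 ≤ r) :
    1 - z * r ≠ 0 := by
  intro h
  have h1 : z * r = 1 := (sub_eq_zero.mp h).symm
  have h2 := congrArg norm h1
  rw [norm_mul, hz, one_mul, Complex.norm_real, Real.norm_of_nonneg h0, norm_one] at h2
  rw [h2, Complex.ofReal_one, mul_one] at h1
  exact hz1 h1

theorem one_sub_mul_exp_ne_zero {z : ℂ} (hz : ‖z‖ = 1) (hz1 : z ≠ 1) (t : ℝ) :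
    1 - z * Complex.exp (-(t : ℂ)) ≠ 0 := by
  have := one_sub_mul_ofReal_ne_zero hz hz1 (Real.exp_pos (-t)).le
  push_cast at this
  exact this

/-- In the variable `r = e^(-t)` this is a bound for a continuous function on the compact interval
`[0, 1]`. -/
theorem exists_norm_inv_one_sub_mul_exp_le {z : ℂ} (hz : ‖z‖ = 1) (hz1 : z ≠ 1) :
    ∃ C : ℝ, 0 ≤ C ∧ ∀ t : ℝ, 0 < t → ‖(1 - z * Complex.exp (-(t : ℂ)))⁻¹‖ ≤ C := by
  have hc : ContinuousOn (fun r : ℝ => (1 - z * (r : ℂ))⁻¹) (Set.Icc 0 1) :=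
    ContinuousOn.inv₀ (by fun_prop) fun r hr => one_sub_mul_ofReal_ne_zero hz hz1 hr.1
  obtain ⟨C, hC⟩ := isCompact_Icc.exists_bound_of_continuousOn hc
  refine ⟨C, (norm_nonneg _).trans (hC 0 (by simp)), fun t ht => ?_⟩
  have := hC (Real.exp (-t)) ⟨(Real.exp_pos _).le, Real.exp_le_one_iff.mpr (by linarith)⟩
  push_cast at this
  exact this

theorem norm_lerch_integrand_le {z s v : ℂ} {C : ℝ} {t : ℝ} (ht : 0 < t)
    (hC : ‖(1 - z * Complex.exp (-(t : ℂ)))⁻¹‖ ≤ C) :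
    ‖(t : ℂ) ^ (s - 1) * Complex.exp (-v * t) / (1 - z * Complex.exp (-(t : ℂ)))‖ ≤
      C * (t ^ (s.re - 1) * Real.exp (-v.re * t)) := by
  rw [div_eq_mul_inv, norm_mul, norm_cpow_mul_exp_neg_mul s v ht, mul_comm C]
  gcongr

theorem integrableOn_lerch_integrand {z s v : ℂ} (hz : ‖z‖ = 1) (hz1 : z ≠ 1) (hs : 0 < s.re)
    (hv : 0 < v.re) :
    IntegrableOn (fun t : ℝ => (t : ℂ) ^ (s - 1) * Complex.exp (-v * t) /
      (1 - z * Complex.exp (-(t : ℂ)))) (Set.Ioi 0) := by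
  obtain ⟨C, -, hC⟩ := exists_norm_inv_one_sub_mul_exp_le hz hz1
  refine ((integrableOn_rpow_sub_one_mul_exp hs hv).const_mul C).mono' ?_ ?_
  · exact ((continuousOn_cpow_mul_exp s v).div (by fun_prop)
      fun t _ => one_sub_mul_exp_ne_zero hz hz1 t).aestronglyMeasurable measurableSet_Ioi
  · filter_upwards [ae_restrict_mem measurableSet_Ioi] with t ht
      using norm_lerch_integrand_le ht (hC t ht)

/-- Split `1/(1 - z e^(-t)) = 1 + z e^(-t)/(1 - z e^(-t))`; the first summand is a Gamma integral.
-/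
theorem lerchIntegral_eq_add {z s v : ℂ} (hz : ‖z‖ = 1) (hz1 : z ≠ 1) (hs : 0 < s.re)
    (hv : 0 < v.re) :
    lerchIntegral z s v = v ^ (-s) + z * lerchIntegral z s (v + 1) := by
  have hv1 : 0 < (v + 1).re := by simp only [Complex.add_re, Complex.one_re]; linarith
  have hΓ : Complex.Gamma s ≠ 0 := Complex.Gamma_ne_zero_of_re_pos hs
  have h : ∫ t in Set.Ioi (0 : ℝ),
      (t : ℂ) ^ (s - 1) * Complex.exp (-v * t) / (1 - z * Complex.exp (-(t : ℂ))) =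
      Complex.Gamma s * v ^ (-s) + z * ∫ t in Set.Ioi (0 : ℝ),
      (t : ℂ) ^ (s - 1) * Complex.exp (-(v + 1) * t) / (1 - z * Complex.exp (-(t : ℂ))) := by
    rw [← integral_cpow_mul_exp_neg_mul hs hv, ← integral_const_mul,
      ← integral_add (integrableOn_cpow_mul_exp hs hv)
        ((integrableOn_lerch_integrand hz hz1 hs hv1).const_mul z)]
    refine integral_congr_ae (Eventually.of_forall fun t => ?_)
    have hne := one_sub_mul_exp_ne_zero hz hz1 t
    have he : Complex.exp (-(v + 1) * t) = Complex.exp (-v * t) * Complex.exp (-(t : ℂ)) := by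
      rw [← Complex.exp_add]
      ring_nf
    simp only [he]
    rw [div_eq_iff hne, add_mul, mul_assoc z, div_mul_cancel₀ _ hne]
    ring
  rw [lerchIntegral, h, lerchIntegral]
  field_simp

theorem lerchIntegral_eq_sum_add {z s v : ℂ} (hz : ‖z‖ = 1) (hz1 : z ≠ 1) (hs : 0 < s.re)
    (hv : 0 < v.re) (K : ℕ) :
    lerchIntegral z s v = ∑ k ∈ Finset.range K, z ^ k * (v + k) ^ (-s) +
      z ^ K * lerchIntegral z s (v + K) := by
  induction K with
  | zero => simp
  | succ K ih =>
    have hK : 0 < (v + K).re := by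
      simp only [Complex.add_re, Complex.natCast_re]
      positivity
    rw [ih, Finset.sum_range_succ, lerchIntegral_eq_add hz hz1 hs hK, pow_succ]
    push_cast
    rw [add_assoc v]
    ring

theorem lerchPhi_eq_sum_add {z s v : ℂ} (hz : ‖z‖ = 1) (hz1 : z ≠ 1) (hs : 0 < s.re) {M : ℕ}
    (hM : ⌊1 - v.re⌋₊ ≤ M) :
    lerchPhi z s v = ∑ k ∈ Finset.range M, z ^ k * (v + k) ^ (-s) +
      z ^ M * lerchIntegral z s (v + M) := by
  obtain ⟨K, rfl⟩ := Nat.exists_eq_add_of_le hM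
  have hv : 0 < (v + (⌊1 - v.re⌋₊ : ℕ)).re := by
    simp only [Complex.add_re, Complex.natCast_re]
    linarith [Nat.lt_floor_add_one (1 - v.re)]
  rw [lerchPhi, if_neg (by rw [hz]; exact lt_irrefl 1), lerchIntegral_eq_sum_add hz hz1 hs hv K,
    Finset.sum_range_add, mul_add, Finset.mul_sum, ← add_assoc]
  push_cast
  simp only [pow_add, mul_assoc, add_assoc]

/-! ### Convergence of the Lerch series and its derivatives near `s = 1` -/

theorem norm_lerchIntegral_le {z s v : ℂ} {C : ℝ}
    (hC : ∀ t : ℝ, 0 < t → ‖(1 - z * Complex.exp (-(t : ℂ)))⁻¹‖ ≤ C) (hs : 0 < s.re)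
    (hv : 0 < v.re) :
    ‖lerchIntegral z s v‖ ≤
      ‖(Complex.Gamma s)⁻¹‖ * (C * ((1 / v.re) ^ s.re * Real.Gamma s.re)) := by
  rw [lerchIntegral, norm_mul, one_div]
  gcongr
  rw [← Real.integral_rpow_mul_exp_neg_mul_Ioi hs hv, ← integral_const_mul]
  refine norm_integral_le_of_norm_le ?_ ?_
  · simpa only [neg_mul] using (integrableOn_rpow_sub_one_mul_exp hs hv).const_mul C
  · filter_upwards [ae_restrict_mem measurableSet_Ioi] with t ht
    simpa only [neg_mul] using norm_lerch_integrand_le (s := s) (v := v) ht (hC t ht)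

theorem half_le_re_of_mem_closedBall {s : ℂ} (hs : s ∈ Metric.closedBall (1 : ℂ) (1 / 2)) :
    1 / 2 ≤ s.re := by
  have h := (Complex.abs_re_le_norm (s - 1)).trans (mem_closedBall_iff_norm.mp hs)
  rw [Complex.sub_re, Complex.one_re] at h
  linarith [(abs_le.mp h).1]

theorem exists_norm_inv_Gamma_mul_Gamma_re_le :
    ∃ B : ℝ, 0 ≤ B ∧ ∀ s ∈ Metric.closedBall (1 : ℂ) (1 / 2),
      ‖(Complex.Gamma s)⁻¹‖ * Real.Gamma s.re ≤ B := by
  have hc : ContinuousOn (fun s : ℂ => ‖(Complex.Gamma s)⁻¹‖ * Real.Gamma s.re)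
      (Metric.closedBall (1 : ℂ) (1 / 2)) := by
    refine ContinuousOn.mul (fun s hs => ?_) (fun s hs => ?_)
    · exact (Complex.differentiable_one_div_Gamma s).continuousAt.norm.continuousWithinAt
    · have h0 : 0 < s.re := by linarith [half_le_re_of_mem_closedBall hs]
      have h1 : ContinuousAt Real.Gamma s.re := (Real.differentiableOn_Gamma_Ioi.differentiableAt
        (Ioi_mem_nhds h0)).continuousAt
      exact (h1.comp Complex.continuous_re.continuousAt).continuousWithinAt
  obtain ⟨B, hB⟩ := (isCompact_closedBall (1 : ℂ) (1 / 2)).exists_bound_of_continuousOn hc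
  exact ⟨B, (norm_nonneg _).trans (hB 1 (by simp)), fun s hs => (le_abs_self _).trans (hB s hs)⟩

/-- The remainder is `z^M` times a Lerch integral at `v + M`. On the disc `s.re ≥ 1/2`, so it is at
most a constant times `(v.re + M)^(-1/2)`. -/
theorem tendstoUniformlyOn_lerchPhi {z : ℂ} (hz : ‖z‖ = 1) (hz1 : z ≠ 1) (v : ℂ) :
    TendstoUniformlyOn (fun (M : ℕ) (s : ℂ) => ∑ k ∈ Finset.range M, z ^ k * (v + k) ^ (-s))
      (fun s => lerchPhi z s v) atTop (Metric.ball (1 : ℂ) (1 / 2)) := by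
  obtain ⟨C, hC0, hC⟩ := exists_norm_inv_one_sub_mul_exp_le hz hz1
  obtain ⟨B, hB0, hB⟩ := exists_norm_inv_Gamma_mul_Gamma_re_le
  have hlim : Tendsto (fun M : ℕ => B * C * (v.re + M) ^ (-(1 / 2) : ℝ)) atTop (nhds 0) := by
    rw [← mul_zero (B * C)]
    exact ((tendsto_rpow_neg_atTop (by norm_num)).comp
      (tendsto_atTop_add_const_left _ _ tendsto_natCast_atTop_atTop)).const_mul _
  rw [Metric.tendstoUniformlyOn_iff]
  intro ε hε
  filter_upwards [hlim.eventually (gt_mem_nhds hε), eventually_ge_atTop ⌊1 - v.re⌋₊,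
    tendsto_natCast_atTop_atTop.eventually (eventually_ge_atTop (1 - v.re))] with M hM hM1 hM2 s hs
  have hs' := half_le_re_of_mem_closedBall (Metric.ball_subset_closedBall hs)
  have hs0 : 0 < s.re := by linarith
  have hx : 1 ≤ v.re + M := by linarith
  have hre : (v + M).re = v.re + M := by simp
  rw [lerchPhi_eq_sum_add hz hz1 hs0 hM1, dist_eq_norm, add_sub_cancel_left, norm_mul, norm_pow, hz,
    one_pow, one_mul]
  refine lt_of_le_of_lt ?_ hM
  refine (norm_lerchIntegral_le hC hs0 (by rw [hre]; linarith)).trans ?_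
  rw [hre]
  have hp : (1 / (v.re + M)) ^ s.re ≤ (v.re + M) ^ (-(1 / 2) : ℝ) := by
    rw [one_div, ← Real.rpow_neg_eq_inv_rpow]
    exact Real.rpow_le_rpow_of_exponent_le hx (by linarith)
  have hΓ := (Real.Gamma_pos_of_pos hs0).le
  calc ‖(Complex.Gamma s)⁻¹‖ * (C * ((1 / (v.re + M)) ^ s.re * Real.Gamma s.re))
      = (‖(Complex.Gamma s)⁻¹‖ * Real.Gamma s.re) * C * (1 / (v.re + M)) ^ s.re := by ring
    _ ≤ B * C * (v.re + M) ^ (-(1 / 2) : ℝ) := by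
        gcongr
        exact hB s (Metric.ball_subset_closedBall hs)

theorem hasDerivAt_log_pow_mul_cpow_neg (i : ℕ) {w : ℂ} (hw : w ≠ 0) (s : ℂ) :
    HasDerivAt (fun s : ℂ => (-Complex.log w) ^ i * w ^ (-s))
      ((-Complex.log w) ^ (i + 1) * w ^ (-s)) s := by
  have h := (((hasDerivAt_id s).neg).const_cpow (c := w) (Or.inl hw)).const_mul
    ((-Complex.log w) ^ i)
  refine h.congr_deriv ?_
  simp only [Pi.neg_apply, id]
  ring

theorem hasDerivAt_sum_log_pow_mul_cpow_neg (i : ℕ) (z : ℂ) {v : ℂ} (hv : ∀ m : ℕ, v ≠ -m)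
    (M : ℕ) (s : ℂ) :
    HasDerivAt
      (fun s : ℂ => ∑ k ∈ Finset.range M, z ^ k * ((-Complex.log (v + k)) ^ i * (v + k) ^ (-s)))
      (∑ k ∈ Finset.range M, z ^ k * ((-Complex.log (v + k)) ^ (i + 1) * (v + k) ^ (-s))) s :=
  HasDerivAt.fun_sum fun k _ => (hasDerivAt_log_pow_mul_cpow_neg i
    (fun h => hv k (eq_neg_of_add_eq_zero_left h)) s).const_mul _

/-- Weierstrass: a locally uniform limit of holomorphic functions may be differentiated, here
repeatedly. -/
theorem tendstoLocallyUniformlyOn_iteratedDeriv_lerchPhi {z : ℂ} (hz : ‖z‖ = 1) (hz1 : z ≠ 1)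
    {v : ℂ} (hv : ∀ m : ℕ, v ≠ -m) (i : ℕ) :
    TendstoLocallyUniformlyOn
      (fun (M : ℕ) (s : ℂ) =>
        ∑ k ∈ Finset.range M, z ^ k * ((-Complex.log (v + k)) ^ i * (v + k) ^ (-s)))
      (iteratedDeriv i fun s => lerchPhi z s v) atTop (Metric.ball (1 : ℂ) (1 / 2)) := by
  induction i with
  | zero =>
    simpa only [pow_zero, one_mul, iteratedDeriv_zero] using
      (tendstoUniformlyOn_lerchPhi hz hz1 v).tendstoLocallyUniformlyOn
  | succ i ih =>
    rw [iteratedDeriv_succ]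
    refine (ih.deriv (Eventually.of_forall fun M s _ =>
      (hasDerivAt_sum_log_pow_mul_cpow_neg i z hv M s).differentiableAt.differentiableWithinAt)
      Metric.isOpen_ball).congr fun M s _ => ?_
    exact (hasDerivAt_sum_log_pow_mul_cpow_neg i z hv M s).deriv

theorem analyticAt_lerchPhi_one {z : ℂ} (hz : ‖z‖ = 1) (hz1 : z ≠ 1) {v : ℂ}
    (hv : ∀ m : ℕ, v ≠ -m) : AnalyticAt ℂ (fun s => lerchPhi z s v) 1 := by
  have h := tendstoLocallyUniformlyOn_iteratedDeriv_lerchPhi hz hz1 hv 0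
  rw [iteratedDeriv_zero] at h
  exact (h.differentiableOn (Eventually.of_forall fun M s _ =>
    (hasDerivAt_sum_log_pow_mul_cpow_neg 0 z hv M s).differentiableAt.differentiableWithinAt)
    Metric.isOpen_ball).analyticAt (Metric.ball_mem_nhds _ (by norm_num))

theorem tendsto_iteratedDeriv_lerchPhi_one {z : ℂ} (hz : ‖z‖ = 1) (hz1 : z ≠ 1) {v : ℂ}
    (hv : ∀ m : ℕ, v ≠ -m) (i : ℕ) :
    Tendsto (fun M : ℕ => ∑ k ∈ Finset.range M, z ^ k * ((-Complex.log (v + k)) ^ i / (v + k)))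
      atTop (nhds (iteratedDeriv i (fun s => lerchPhi z s v) 1)) := by
  have h := (tendstoLocallyUniformlyOn_iteratedDeriv_lerchPhi hz hz1 hv i).tendsto_at
    (Metric.mem_ball_self (by norm_num))
  simpa only [Complex.cpow_neg_one, ← div_eq_mul_inv] using h

/-! ### The root-of-unity filter -/

theorem sum_range_mul_eq_sum_sum {M : Type*} [AddCommMonoid M] (f : ℕ → M) (d N : ℕ) :
    ∑ k ∈ Finset.range (d * N), f k =
      ∑ m ∈ Finset.range N, ∑ r ∈ Finset.range d, f (d * m + r) := by
  induction N with
  | zero => simp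
  | succ N ih => rw [Nat.mul_succ, Finset.sum_range_add, ih, Finset.sum_range_succ]

theorem exp_lerch_ne_one (n j : ℕ) :
    -Complex.exp (2 * Complex.I * Real.pi * j / (2 * n + 1)) ≠ 1 := by
  intro h
  have h1 := congrArg (· ^ (2 * n + 1)) h
  have hn : (2 * n + 1 : ℂ) ≠ 0 := by exact_mod_cast (2 * n).succ_ne_zero
  have h2 : Complex.exp (2 * Complex.I * Real.pi * j / (2 * n + 1)) ^ (2 * n + 1) = 1 := by
    rw [← Complex.exp_nat_mul, Complex.exp_eq_one_iff]
    refine ⟨j, ?_⟩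
    push_cast
    field_simp
  simp only [Odd.neg_pow (odd_two_mul_add_one n), h2, one_pow] at h1
  norm_num at h1

theorem norm_exp_lerch (n j : ℕ) :
    ‖-Complex.exp (2 * Complex.I * Real.pi * j / (2 * n + 1))‖ = 1 := by
  rw [norm_neg, show (2 * Complex.I * Real.pi * j / (2 * n + 1) : ℂ) =
    ((2 * Real.pi * j / (2 * n + 1) : ℝ) : ℂ) * Complex.I by push_cast; ring,
    Complex.norm_exp_ofReal_mul_I]

theorem weight_mul_exp_lerch_pow (n j k : ℕ) :
    (-1 : ℂ) ^ ((j : ℂ) * (1 / (2 * n + 1) + 1)) *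
      (-Complex.exp (2 * Complex.I * Real.pi * j / (2 * n + 1))) ^ k =
    (-1) ^ k * (Complex.exp (2 * Real.pi * Complex.I / ((2 * n + 1 : ℕ) : ℂ)) ^ (k + n + 1)) ^ j
    := by
  have hn : (2 * n + 1 : ℂ) ≠ 0 := by exact_mod_cast (2 * n).succ_ne_zero
  rw [neg_pow (Complex.exp _), Complex.cpow_def_of_ne_zero (by norm_num), Complex.log_neg_one,
    ← Complex.exp_nat_mul, ← pow_mul, ← Complex.exp_nat_mul, mul_left_comm, ← Complex.exp_add]
  congr 2
  push_cast
  field_simp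
  ring

theorem sum_weight_mul_exp_lerch_pow (n k : ℕ) :
    ∑ j ∈ Finset.range (2 * n + 1), (-1 : ℂ) ^ ((j : ℂ) * (1 / (2 * n + 1) + 1)) *
      (-Complex.exp (2 * Complex.I * Real.pi * j / (2 * n + 1))) ^ k =
    if 2 * n + 1 ∣ k + n + 1 then (-1 : ℂ) ^ k * (2 * n + 1) else 0 := by
  have hζ := Complex.isPrimitiveRoot_exp (2 * n + 1) (2 * n).succ_ne_zero
  simp only [weight_mul_exp_lerch_pow]
  rw [← Finset.mul_sum]
  split_ifs with h
  · rw [(hζ.pow_eq_one_iff_dvd _).mpr h]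
    simp
  · have h1 : Complex.exp (2 * Real.pi * Complex.I / ((2 * n + 1 : ℕ) : ℂ)) ^ (k + n + 1) ≠ 1 :=
      fun h' => h ((hζ.pow_eq_one_iff_dvd _).mp h')
    rw [geom_sum_eq h1, ← pow_mul, mul_comm (k + n + 1), pow_mul, hζ.pow_eq_one, one_pow, sub_self,
      zero_div, mul_zero]

/-- Since `0 < r + n + 1 < 3(2n+1)`, the only possible multiples are `2n+1` and `2(2n+1)`. -/
theorem dvd_add_succ_iff {n m r : ℕ} (hr : r < 4 * n + 2) :
    2 * n + 1 ∣ (4 * n + 2) * m + r + n + 1 ↔ r = n ∨ r = 3 * n + 1 := by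
  rw [show (4 * n + 2) * m + r + n + 1 = (2 * n + 1) * (2 * m) + (r + n + 1) by ring,
    Nat.dvd_add_right (dvd_mul_right _ _)]
  constructor
  · rintro ⟨c, hc⟩
    have h1 : 0 < c := by
      rcases Nat.eq_zero_or_pos c with rfl | h
      · omega
      · exact h
    have h2 : c < 3 := by
      by_contra h
      have := Nat.mul_le_mul_left (2 * n + 1) (not_lt.mp h)
      omega
    interval_cases c <;> omega
  · rintro (rfl | rfl)
    · exact ⟨1, by ring⟩
    · exact ⟨2, by ring⟩

/-- Blocks have the even length `4n+2`, so `(-1)^k` depends only on the residue; the residues `n`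
and `3n+1` have opposite parity, whence the minus sign. -/
theorem sum_weight_mul_sum (n : ℕ) (f : ℕ → ℂ) (M : ℕ) :
    ∑ j ∈ Finset.range (2 * n + 1), (-1 : ℂ) ^ ((j : ℂ) * (1 / (2 * n + 1) + 1)) *
      ∑ k ∈ Finset.range ((4 * n + 2) * M),
        (-Complex.exp (2 * Complex.I * Real.pi * j / (2 * n + 1))) ^ k * f k =
    (-1) ^ n * (2 * n + 1) * ∑ m ∈ Finset.range M,
      (f ((4 * n + 2) * m + n) - f ((4 * n + 2) * m + (3 * n + 1))) := by
  simp only [Finset.mul_sum, ← mul_assoc]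
  rw [Finset.sum_comm]
  simp only [← Finset.sum_mul, sum_weight_mul_exp_lerch_pow]
  rw [sum_range_mul_eq_sum_sum]
  refine Finset.sum_congr rfl fun m _ => ?_
  have h1 : ∀ r ∈ Finset.range (4 * n + 2),
      (if 2 * n + 1 ∣ (4 * n + 2) * m + r + n + 1 then
        (-1 : ℂ) ^ ((4 * n + 2) * m + r) * (2 * n + 1) else 0) * f ((4 * n + 2) * m + r) =
      (if r = n then (-1) ^ n * (2 * n + 1) * f ((4 * n + 2) * m + n) else 0) +
      if r = 3 * n + 1 then -((-1) ^ n * (2 * n + 1) * f ((4 * n + 2) * m + (3 * n + 1))) else 0 := by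
    intro r hr
    rw [if_congr (dvd_add_succ_iff (Finset.mem_range.mp hr)) rfl rfl]
    have he : (-1 : ℂ) ^ ((4 * n + 2) * m) = 1 := Even.neg_one_pow ⟨(2 * n + 1) * m, by ring⟩
    have he2 : (-1 : ℂ) ^ (2 * n) = 1 := Even.neg_one_pow (even_two_mul n)
    by_cases ha : r = n
    · subst ha
      rw [if_pos (Or.inl rfl), if_pos rfl, if_neg (by omega), pow_add, he]
      ring
    · by_cases hb : r = 3 * n + 1
      · subst hb
        rw [if_pos (Or.inr rfl), if_neg ha, if_pos rfl, pow_add, he,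
          show 3 * n + 1 = 2 * n + n + 1 by ring, pow_succ, pow_add, he2]
        ring
      · rw [if_neg (not_or.mpr ⟨ha, hb⟩), if_neg ha, if_neg hb]
        ring
  rw [Finset.sum_congr rfl h1, Finset.sum_add_distrib, Finset.sum_ite_eq', Finset.sum_ite_eq',
    if_pos (Finset.mem_range.mpr (by omega)), if_pos (Finset.mem_range.mpr (by omega))]
  ring

/-! ### Rescaling and the final evaluation -/

theorem neg_log_pow_div_scale (n i m : ℕ) {a p : ℂ} {r : ℕ} (hp : ∀ m : ℕ, p ≠ -m)
    (h : a + r = (4 * n + 2) * p) :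
    (-Complex.log (a + ((4 * n + 2) * m + r : ℕ))) ^ i / (a + ((4 * n + 2) * m + r : ℕ)) =
      (-1) ^ i / (4 * n + 2) *
        (((Real.log (4 * n + 2) : ℂ) + Complex.log (m + p)) ^ i / (m + p)) := by
  have h0 : (m : ℂ) + p ≠ 0 := fun h => hp m (eq_neg_of_add_eq_zero_right h)
  have hd : (0 : ℝ) < 4 * n + 2 := by positivity
  have h1 : a + ((4 * n + 2) * m + r : ℕ) = ((4 * n + 2 : ℝ) : ℂ) * (m + p) := by
    push_cast
    linear_combination h
  rw [h1, Complex.log_ofReal_mul hd h0, neg_pow, mul_div_mul_comm]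
  push_cast
  ring

theorem tendsto_sum_weight_iteratedDeriv (n i : ℕ) {a : ℂ} (ha : ∀ m : ℕ, a ≠ -(m : ℂ)) {p q : ℂ}
    (hp : ∀ m : ℕ, p ≠ -m) (hq : ∀ m : ℕ, q ≠ -m) (hap : a + n = (4 * n + 2) * p)
    (haq : a + (3 * n + 1 : ℕ) = (4 * n + 2) * q) :
    Tendsto (fun M : ℕ => 1 / 2 * (-1) ^ n * (-1) ^ i * ∑ m ∈ Finset.range M,
      (((Real.log (4 * n + 2) : ℂ) + Complex.log (m + p)) ^ i / (m + p) -
        ((Real.log (4 * n + 2) : ℂ) + Complex.log (m + q)) ^ i / (m + q))) atTop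
      (nhds (∑ j ∈ Finset.range (2 * n + 1), (-1 : ℂ) ^ ((j : ℂ) * (1 / (2 * n + 1) + 1)) *
          iteratedDeriv i (fun s : ℂ =>
            lerchPhi (-Complex.exp (2 * Complex.I * Real.pi * j / (2 * n + 1))) s a) 1)) := by
  have h := tendsto_finsetSum (Finset.range (2 * n + 1)) fun j _ =>
    (tendsto_iteratedDeriv_lerchPhi_one (norm_exp_lerch n j) (exp_lerch_ne_one n j) ha i).const_mul
      ((-1 : ℂ) ^ ((j : ℂ) * (1 / (2 * n + 1) + 1)))
  -- Only partial sums of length a multiple of `4n+2` are used; this subsequence has the same limit.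
  refine (h.comp (tendsto_id.const_mul_atTop' (Nat.succ_pos (4 * n + 1)))).congr fun M => ?_
  simp only [Function.comp_apply, id]
  rw [Nat.succ_eq_add_one, show 4 * n + 1 + 1 = 4 * n + 2 by rfl,
    sum_weight_mul_sum n (fun k => (-Complex.log (a + k)) ^ i / (a + k)) M]
  simp only [neg_log_pow_div_scale n i _ hp hap, neg_log_pow_div_scale n i _ hq haq]
  rw [Finset.mul_sum, Finset.mul_sum]
  refine Finset.sum_congr rfl fun m _ => ?_
  have hn : (2 * n + 1 : ℂ) ≠ 0 := by exact_mod_cast (2 * n).succ_ne_zero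
  rw [show (4 * n + 2 : ℂ) = 2 * (2 * n + 1) by ring]
  field_simp

theorem mainTheorem11 (n : ℕ) (a : ℂ) (ha : ∀ m : ℕ, a ≠ -(m : ℂ)) :
    (∀ j ∈ Finset.range (2 * n + 1),
      AnalyticAt ℂ (fun s : ℂ =>
        lerchPhi (-Complex.exp (2 * Complex.I * Real.pi * j / (2 * n + 1))) s a) 1) ∧
    (∑ j ∈ Finset.range (2 * n + 1),
        (-1 : ℂ) ^ ((j : ℂ) * (1 / (2 * n + 1) + 1)) *
          deriv (fun s : ℂ =>
            lerchPhi (-Complex.exp (2 * Complex.I * Real.pi * j / (2 * n + 1))) s a) 1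
      = 1 / 2 * (-1 : ℂ) ^ n *
        (-stieltjesGamma 1 ((a + n) / (4 * n + 2))
          + stieltjesGamma 1 ((a + 3 * n + 1) / (4 * n + 2))
          + (Real.log (4 * n + 2) : ℂ) *
            (Complex.digamma ((a + n) / (4 * n + 2))
              - Complex.digamma ((a + 3 * n + 1) / (4 * n + 2))))) ∧
    (∑ j ∈ Finset.range (2 * n + 1),
        (-1 : ℂ) ^ ((j : ℂ) * (1 / (2 * n + 1) + 1)) *
          iteratedDeriv 2 (fun s : ℂ =>
            lerchPhi (-Complex.exp (2 * Complex.I * Real.pi * j / (2 * n + 1))) s a) 1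
      = 1 / 2 * (-1 : ℂ) ^ n *
        (stieltjesGamma 2 ((a + n) / (4 * n + 2))
          - stieltjesGamma 2 ((a + 3 * n + 1) / (4 * n + 2))
          + 2 * (Real.log (4 * n + 2) : ℂ) *
            (stieltjesGamma 1 ((a + n) / (4 * n + 2))
              - stieltjesGamma 1 ((a + 3 * n + 1) / (4 * n + 2)))
          - ((Real.log (2 * n + 1) : ℂ) * (Real.log (8 * n + 4) : ℂ) + (Real.log 2 : ℂ) ^ 2) *
            (Complex.digamma ((a + n) / (4 * n + 2))
              - Complex.digamma ((a + 3 * n + 1) / (4 * n + 2))))) := by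
  have hd : (4 * n + 2 : ℂ) ≠ 0 := by exact_mod_cast (4 * n + 1).succ_ne_zero
  have hp : ∀ m : ℕ, (a + n) / (4 * n + 2) ≠ -(m : ℂ) := fun m h => by
    refine ha (n + m * (4 * n + 2)) ?_
    rw [div_eq_iff hd] at h
    push_cast
    linear_combination h
  have hq : ∀ m : ℕ, (a + 3 * n + 1) / (4 * n + 2) ≠ -(m : ℂ) := fun m h => by
    refine ha (3 * n + 1 + m * (4 * n + 2)) ?_
    rw [div_eq_iff hd] at h
    push_cast
    linear_combination h
  have hap : a + n = (4 * n + 2) * ((a + n) / (4 * n + 2)) := (mul_div_cancel₀ _ hd).symm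
  have haq : a + (3 * n + 1 : ℕ) = (4 * n + 2) * ((a + 3 * n + 1) / (4 * n + 2)) := by
    rw [mul_div_cancel₀ _ hd]
    push_cast
    ring
  -- The shift `q = p + 1/2` puts both points within the range of `tendsto_sum_log_pow_div_sub`.
  have hpq : (a + 3 * n + 1) / (4 * n + 2) = (a + n) / (4 * n + 2) + ((1 / 2 : ℝ) : ℂ) := by
    rw [div_eq_iff hd, add_mul, div_mul_cancel₀ _ hd]
    push_cast
    ring
  have hlim := fun i => tendsto_sum_weight_iteratedDeriv n i ha hp hq hap haq
  have hS := fun k => tendsto_sum_log_pow_div_sub k ((a + n) / (4 * n + 2)) (t := 1 / 2)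
    (by norm_num) (by norm_num)
  rw [← hpq] at hS
  have hS0 := tendsto_sum_one_div_sub hp hq
  -- With `x = log 2` and `y = log(2n+1)`, this is `y(2x + y) + x^2 = (x + y)^2`.
  have hL : ((Real.log (2 * n + 1) : ℂ) * (Real.log (8 * n + 4) : ℂ) + (Real.log 2 : ℂ) ^ 2) =
      (Real.log (4 * n + 2) : ℂ) ^ 2 := by
    have hn : (0 : ℝ) < 2 * n + 1 := by positivity
    rw [show (8 * n + 4 : ℝ) = 2 * (2 * (2 * n + 1)) by ring,
      show (4 * n + 2 : ℝ) = 2 * (2 * n + 1) by ring, Real.log_mul two_ne_zero (by positivity),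
      Real.log_mul two_ne_zero hn.ne']
    push_cast
    ring
  generalize (a + n) / (4 * n + 2) = p at *
  generalize (a + 3 * n + 1) / (4 * n + 2) = q at *
  rw [hL]
  generalize (Real.log (4 * n + 2) : ℂ) = L at *
  refine ⟨fun j _ => analyticAt_lerchPhi_one (norm_exp_lerch n j) (exp_lerch_ne_one n j) ha,
    ?_, ?_⟩
  · simp only [← iteratedDeriv_one]
    refine tendsto_nhds_unique (hlim 1) ?_
    have h := (((hS 1).add (hS0.const_mul L)).neg).const_mul (1 / 2 * (-1 : ℂ) ^ n)
    convert! h using 2 with M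
    · simp only [Finset.mul_sum, ← Finset.sum_add_distrib, ← Finset.sum_neg_distrib]
      exact Finset.sum_congr rfl fun m _ => by ring
    · ring
  · refine tendsto_nhds_unique (hlim 2) ?_
    -- These are the three terms of `(L + log)^2`; the limit in `hS0` is minus the digamma
    -- difference, which gives the last sign.
    have h := (((hS 2).add ((hS 1).const_mul (2 * L))).add (hS0.const_mul (L ^ 2))).const_mul
      (1 / 2 * (-1 : ℂ) ^ n)
    convert! h using 2 with M
    · simp only [Finset.mul_sum, ← Finset.sum_add_distrib]
      exact Finset.sum_congr rfl fun m _ => by ring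
    · ring
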